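/- Let $H$ be a complex Hilbert space, let $H\hat\otimes_2 H$ be the Hilbertian tensor product (the completion of the algebraic tensor product $H\otimes_{\mathbb C}H$ for the inner product with $\langle u\otimes v,u'\otimes v'\rangle=\langle u,u'\rangle\langle v,v'\rangle$), and let $\mu\colon H\hat\otimes_2 H\to H$ be a bounded linear map with Hilbert adjoint $\mu^\dagger$. Let $\alpha\colon (H\hat\otimes_2 H)\hat\otimes_2 H\to H\hat\otimes_2(H\hat\otimes_2 H)$ and $\sigma\colon H\hat\otimes_2 H\to H\hat\otimes_2 H$ be the canonical unitary associativity and symmetry maps. Assume that $(H,\mu)$ is a commutative Hilbertian Frobenius semigroup, that is, $\mu\circ(\mu\hat\otimes_2 \mathrm{id})=\mu\circ(\mathrm{id}\hat\otimes_2\mu)\circ\alpha$, $\mu\circ\sigma=\mu$, and $$(\mu\hat\otimes_2\mathrm{id})\circ\alpha^{-1}\circ(\mathrm{id}\hat\otimes_2\mu^\dagger)=\mu^\dagger\circ\mu=(\mathrm{id}\hat\otimes_2\mu)\circ\alpha\circ(\mu^\dagger\hat\otimes_2\mathrm{id}).$$ Write $uv=\mu(u\otimes v)$, and let $M\colon H\to\mathcal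 B(H)$, $M_u(v)=uv$, be the regular representation. The Jacobson radical of $(H,\mu)$ is the intersection of all maximal modular left ideals of the (not necessarily unital) algebra $H$ with product $uv$ (all of $H$ if there are none), and $(H,\mu)$ is semisimple if its Jacobson radical is $(0)$. Then the following assertions are equivalent. 1. $(H,\mu)$ is semisimple. 2. $(H,\mu)$ is faithful, that is, $\ker M=(0)$. 3. $\mu$ has a dense range. 4. $\mu^\dagger$ is one-to-one. 5. $\mu\circ\mu^\dagger$ is one-to-one. In particular, if $(H,\mu)$ is moreover special, that is, $\mu\circ\mu^\dagger=\mathrm{id}_H$, then $(H,\mu)$ is semisimple. -/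

import Mathlib

open scoped TensorProduct

noncomputable section

namespace HilbertianFrobenius

open UniformSpace

/-! ### The Hilbertian tensor product -/

/-- The Hilbertian tensor product of two Hilbert spaces: the completion of the algebraic tensor
product for the inner product determined by `⟪x ⊗ y, x' ⊗ y'⟫ = ⟪x, x'⟫ * ⟪y, y'⟫`. -/
def HTensor (H K : Type*) [NormedAddCommGroup H] [InnerProductSpace ℂ H]
    [NormedAddCommGroup K] [InnerProductSpace ℂ K] : Type _ :=
  Completion (H ⊗[ℂ] K)

section Tensor

variable {H K L H' K' : Type*}
  [NormedAddCommGroup H] [InnerProductSpace ℂ H]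
  [NormedAddCommGroup K] [InnerProductSpace ℂ K]
  [NormedAddCommGroup L] [InnerProductSpace ℂ L]
  [NormedAddCommGroup H'] [InnerProductSpace ℂ H']
  [NormedAddCommGroup K'] [InnerProductSpace ℂ K']

instance : NormedAddCommGroup (HTensor H K) :=
  inferInstanceAs (NormedAddCommGroup (Completion (H ⊗[ℂ] K)))

instance : InnerProductSpace ℂ (HTensor H K) :=
  inferInstanceAs (InnerProductSpace ℂ (Completion (H ⊗[ℂ] K)))

instance : CompleteSpace (HTensor H K) :=
  inferInstanceAs (CompleteSpace (Completion (H ⊗[ℂ] K)))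

variable (H K) in
/-- The isometric inclusion of the algebraic tensor product in its completion. -/
def incl : (H ⊗[ℂ] K) →ₗᵢ[ℂ] HTensor H K :=
  (Completion.toComplₗᵢ : (H ⊗[ℂ] K) →ₗᵢ[ℂ] Completion (H ⊗[ℂ] K))

theorem denseRange_incl : DenseRange (incl H K) :=
  Completion.denseRange_coe

variable (H K) in
/-- The canonical bounded bilinear map sending `x`, `y` to the elementary tensor `x ⊗ y` of the
Hilbertian tensor product. -/
def tmulL : H →L[ℂ] K →L[ℂ] HTensor H K :=
  (incl H K).toContinuousLinearMap.postcomp K ∘L TensorProduct.mkL ℂ H K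

theorem tmulL_apply (x : H) (y : K) : tmulL H K x y = incl H K (x ⊗ₜ[ℂ] y) := rfl

/-- The Hilbertian tensor product of two bounded linear maps. -/
def hmap (f : H →L[ℂ] H') (g : K →L[ℂ] K') : HTensor H K →L[ℂ] HTensor H' K' :=
  ((incl H' K').toContinuousLinearMap ∘L TensorProduct.mapL f g).extend
    (incl H K).toContinuousLinearMap

theorem hmap_tmulL (f : H →L[ℂ] H') (g : K →L[ℂ] K') (x : H) (y : K) :
    hmap f g (tmulL H K x y) = tmulL H' K' (f x) (g y) :=
  ContinuousLinearMap.extend_eq (e := (incl H K).toContinuousLinearMap) _ denseRange_incl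
    (incl H K).isometry.isUniformInducing (x ⊗ₜ y)

variable (H K) in
/-- The symmetry constraint, the unitary map sending `x ⊗ y` to `y ⊗ x`. -/
def symmetry : HTensor H K ≃ₗᵢ[ℂ] HTensor K H :=
  (TensorProduct.commIsometry ℂ H K).toLinearEquiv.extendOfIsometry
    (incl H K).toLinearMap (incl K H).toLinearMap denseRange_incl denseRange_incl
    (fun x ↦ ((incl K H).norm_map _).trans
      ((LinearIsometryEquiv.norm_map _ x).trans ((incl H K).norm_map x).symm))

theorem symmetry_tmulL (x : H) (y : K) : symmetry H K (tmulL H K x y) = tmulL K H y x :=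
  LinearEquiv.extendOfIsometry_eq (TensorProduct.commIsometry ℂ H K).toLinearEquiv
    (incl H K).toLinearMap (incl K H).toLinearMap denseRange_incl denseRange_incl _ (x ⊗ₜ y)

variable (H K L) in
/-- The isometric inclusion of the algebraic tensor product `(H ⊗ K) ⊗ L` in the Hilbertian one. -/
def inclLeft : ((H ⊗[ℂ] K) ⊗[ℂ] L) →ₗᵢ[ℂ] HTensor (HTensor H K) L :=
  (incl (HTensor H K) L).comp ((incl H K).rTensor L)

variable (H K L) in
/-- The isometric inclusion of the algebraic tensor product `H ⊗ (K ⊗ L)` in the Hilbertian one. -/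
def inclRight : (H ⊗[ℂ] (K ⊗[ℂ] L)) →ₗᵢ[ℂ] HTensor H (HTensor K L) :=
  (incl H (HTensor K L)).comp ((incl K L).lTensor H)

theorem inclLeft_tmul (t : H ⊗[ℂ] K) (z : L) :
    inclLeft H K L (t ⊗ₜ z) = tmulL (HTensor H K) L (incl H K t) z := by
  rw [tmulL_apply]
  exact congrArg (incl (HTensor H K) L) (LinearMap.rTensor_tmul L (incl H K).toLinearMap z t)

theorem inclRight_tmul (x : H) (t : K ⊗[ℂ] L) :
    inclRight H K L (x ⊗ₜ t) = tmulL H (HTensor K L) x (incl K L t) := by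
  rw [tmulL_apply]
  exact congrArg (incl H (HTensor K L)) (LinearMap.lTensor_tmul H (incl K L).toLinearMap x t)

theorem denseRange_of_tmulL_mem {E : Type*} [AddCommGroup E] [Module ℂ E]
    (e : E →ₗ[ℂ] HTensor H K)
    (h : ∀ x y, tmulL H K x y ∈ (LinearMap.range e).topologicalClosure) :
    DenseRange e := by
  have key : ∀ t : H ⊗[ℂ] K,
      incl H K t ∈ (LinearMap.range e).topologicalClosure := by
    intro t
    induction t using TensorProduct.induction_on with
    | zero => rw [map_zero]; exact zero_mem _
    | tmul x y => exact h x y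
    | add a b ha hb => rw [map_add]; exact add_mem ha hb
  intro z
  have hz : z ∈ (LinearMap.range e).topologicalClosure :=
    denseRange_incl.induction_on (p := fun z ↦
      z ∈ (LinearMap.range e).topologicalClosure) z
      (Submodule.isClosed_topologicalClosure _) key
  rwa [← SetLike.mem_coe, Submodule.topologicalClosure_coe, LinearMap.coe_range] at hz

theorem denseRange_inclLeft : DenseRange (inclLeft H K L).toLinearMap := by
  refine denseRange_of_tmulL_mem (inclLeft H K L).toLinearMap fun t z ↦ ?_
  set S := (LinearMap.range (inclLeft H K L).toLinearMap).topologicalClosure with hS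
  have hc : IsClosed {t | tmulL (HTensor H K) L t z ∈ S} :=
    IsClosed.preimage ((tmulL (HTensor H K) L).flip z).continuous
      (Submodule.isClosed_topologicalClosure _)
  refine (denseRange_incl (H := H) (K := K)).induction_on t hc fun a ↦ ?_
  change tmulL (HTensor H K) L (incl H K a) z ∈ S
  rw [← inclLeft_tmul]
  exact Submodule.le_topologicalClosure _ (LinearMap.mem_range_self _ _)

theorem denseRange_inclRight : DenseRange (inclRight H K L).toLinearMap := by
  refine denseRange_of_tmulL_mem (inclRight H K L).toLinearMap fun x t ↦ ?_
  set S := (LinearMap.range (inclRight H K L).toLinearMap).topologicalClosure with hS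
  have hc : IsClosed {t | tmulL H (HTensor K L) x t ∈ S} :=
    IsClosed.preimage (tmulL H (HTensor K L) x).continuous
      (Submodule.isClosed_topologicalClosure _)
  refine (denseRange_incl (H := K) (K := L)).induction_on t hc fun a ↦ ?_
  change tmulL H (HTensor K L) x (incl K L a) ∈ S
  rw [← inclRight_tmul]
  exact Submodule.le_topologicalClosure _ (LinearMap.mem_range_self _ _)

variable (H K L) in
/-- The associativity constraint, the unitary map sending `(x ⊗ y) ⊗ z` to `x ⊗ (y ⊗ z)`. -/
def associator : HTensor (HTensor H K) L ≃ₗᵢ[ℂ] HTensor H (HTensor K L) :=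
  (TensorProduct.assocIsometry ℂ H K L).toLinearEquiv.extendOfIsometry
    (inclLeft H K L).toLinearMap (inclRight H K L).toLinearMap
    denseRange_inclLeft denseRange_inclRight
    (fun x ↦ ((inclRight H K L).norm_map _).trans
      (((TensorProduct.assocIsometry ℂ H K L).norm_map x).trans
        ((inclLeft H K L).norm_map x).symm))

theorem associator_tmulL (x : H) (y : K) (z : L) :
    associator H K L (tmulL (HTensor H K) L (tmulL H K x y) z) =
      tmulL H (HTensor K L) x (tmulL K L y z) := by
  have h : associator H K L (inclLeft H K L ((x ⊗ₜ y) ⊗ₜ z)) =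
      inclRight H K L (x ⊗ₜ (y ⊗ₜ z)) :=
    LinearEquiv.extendOfIsometry_eq (TensorProduct.assocIsometry ℂ H K L).toLinearEquiv
      (inclLeft H K L).toLinearMap (inclRight H K L).toLinearMap
      denseRange_inclLeft denseRange_inclRight _ _
  rwa [inclLeft_tmul, inclRight_tmul] at h

end Tensor

/-! ### The Jacobson radical of a not necessarily unital algebra

An algebra is a complex vector space `A` with a bilinear multiplication
`m : A →ₗ[ℂ] A →ₗ[ℂ] A`; associativity is a separate assumption where it is needed. -/

section Jacobson

variable {A : Type*} [AddCommGroup A] [Module ℂ A]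

/-- `I` is a left ideal of the algebra `(A, m)`. -/
def IsLeftIdeal (m : A →ₗ[ℂ] A →ₗ[ℂ] A) (I : Submodule ℂ A) : Prop :=
  ∀ a x : A, x ∈ I → m a x ∈ I

/-- `I` is a modular left ideal of `(A, m)`: there is an `e` such that `a - a e ∈ I` for all `a`. -/
def IsModularLeftIdeal (m : A →ₗ[ℂ] A →ₗ[ℂ] A) (I : Submodule ℂ A) : Prop :=
  IsLeftIdeal m I ∧ ∃ e : A, ∀ a : A, a - m a e ∈ I

/-- `I` is a maximal modular left ideal of `(A, m)`: a modular left ideal that is maximal among the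
proper left ideals. -/
def IsMaximalModularLeftIdeal (m : A →ₗ[ℂ] A →ₗ[ℂ] A) (I : Submodule ℂ A) : Prop :=
  IsModularLeftIdeal m I ∧ I ≠ ⊤ ∧ ∀ I' : Submodule ℂ A, IsLeftIdeal m I' → I < I' → I' = ⊤

/-- The Jacobson radical of `(A, m)`: the intersection of all its maximal modular left ideals (the
whole of `A` if there are none). -/
def jacobsonRadical (m : A →ₗ[ℂ] A →ₗ[ℂ] A) : Submodule ℂ A :=
  sInf {I | IsMaximalModularLeftIdeal m I}

end Jacobson

/-! ### Hilbertian Frobenius semigroups -/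

section Frobenius

variable {H : Type*} [NormedAddCommGroup H] [InnerProductSpace ℂ H]

/-- The regular representation `M` of `(H, μ)`: `M u v = μ (u ⊗ v)`. It is also the bounded
bilinear multiplication associated with `μ`. -/
def regularRep (μ : HTensor H H →L[ℂ] H) : H →L[ℂ] H →L[ℂ] H :=
  μ.postcomp H ∘L tmulL H H

theorem regularRep_apply (μ : HTensor H H →L[ℂ] H) (u v : H) :
    regularRep μ u v = μ (tmulL H H u v) := rfl

/-- `(H, μ)` is semisimple: the Jacobson radical of its underlying algebra is zero. -/
def IsSemisimple (μ : HTensor H H →L[ℂ] H) : Prop :=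
  jacobsonRadical (regularRep μ).toLinearMap₁₂ = ⊥

/-- `(H, μ)` is a commutative semigroup object in the symmetric monoidal category of Hilbert
spaces and bounded linear maps. -/
structure IsCommSemigroup (μ : HTensor H H →L[ℂ] H) : Prop where
  assoc : μ ∘L hmap μ (.id ℂ H) =
    μ ∘L hmap (.id ℂ H) μ ∘L (associator H H H : _ →L[ℂ] HTensor H (HTensor H H))
  comm : μ ∘L (symmetry H H : HTensor H H →L[ℂ] HTensor H H) = μ

variable [CompleteSpace H]

/-- The Frobenius condition: the Hilbert adjoint of `μ` is a morphism of left modules and of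
right modules, that is, `(μ ⊗ id) α⁻¹ (id ⊗ μ†) = μ† μ = (id ⊗ μ) α (μ† ⊗ id)`. -/
structure IsFrobenius (μ : HTensor H H →L[ℂ] H) : Prop where
  left : hmap μ (.id ℂ H) ∘L
      ((associator H H H).symm : _ →L[ℂ] HTensor (HTensor H H) H) ∘L
      hmap (.id ℂ H) μ.adjoint = μ.adjoint ∘L μ
  right : hmap (.id ℂ H) μ ∘L
      (associator H H H : _ →L[ℂ] HTensor H (HTensor H H)) ∘L
      hmap μ.adjoint (.id ℂ H) = μ.adjoint ∘L μ

/-- `(H, μ)` is a commutative Hilbertian Frobenius semigroup. -/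
structure IsCommFrobeniusSemigroup (μ : HTensor H H →L[ℂ] H) : Prop
    extends IsCommSemigroup μ, IsFrobenius μ

/-- `(H, μ)` is special: its multiplication is coisometric. -/
def IsSpecial (μ : HTensor H H →L[ℂ] H) : Prop :=
  μ ∘L μ.adjoint = .id ℂ H

end Frobenius

end HilbertianFrobenius

end

/-! The Frobenius condition says `μ†(uv) = (M_u ⊗ id) μ†(v)`. Pairing with elementary tensors turns
this into `M_u†(xy) = (M_u† x) y`; with commutativity, every `M_u` is normal (`isStarNormal`), so
`M_u` and `M_u†` have the same kernel. Since `μ† u = 0` means `M_v† u = 0` for all `v`, it means `vu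
= 0` for all `v`: hence `ker μ† = ker M`. Density of the range and injectivity of `μ μ†` are tied to
injectivity of `μ†` by general Hilbert space facts.

The radical also equals `ker M`. An annihilating element lies in every modular ideal. Conversely, if
`x` is in the radical, quasi-regularity makes `k - M_x` surjective for `k ≠ 0`, hence bijective by
normality. So `M_x` is normal with spectral radius zero, and vanishes (`regularRep_eq_zero`). -/

namespace HilbertianFrobenius

section Tensor

variable {H K : Type*} [NormedAddCommGroup H] [InnerProductSpace ℂ H]
  [NormedAddCommGroup K] [InnerProductSpace ℂ K]

/-- Bounded linear maps on a Hilbertian tensor product are determined by their values on elementary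
tensors. -/
theorem hTensor_ext {E : Type*} [NormedAddCommGroup E] [NormedSpace ℂ E]
    {f g : HTensor H K →L[ℂ] E} (h : ∀ x y, f (tmulL H K x y) = g (tmulL H K x y)) : f = g := by
  refine DFunLike.coe_injective
    (denseRange_incl.equalizer f.continuous g.continuous (funext fun t ↦ ?_))
  change f (incl H K t) = g (incl H K t)
  induction t using TensorProduct.induction_on with
  | zero => simp only [map_zero]
  | tmul x y => exact h x y
  | add a b ha hb => simp only [map_add, ha, hb]

theorem inner_tmulL_tmulL (x x' : H) (y y' : K) :
    inner ℂ (tmulL H K x y) (tmulL H K x' y') = inner ℂ x x' * inner ℂ y y' := by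
  rw [tmulL_apply, tmulL_apply, LinearIsometry.inner_map_map, TensorProduct.inner_tmul]

theorem eq_zero_of_inner_tmulL {t : HTensor H K} (h : ∀ x y, inner ℂ t (tmulL H K x y) = 0) :
    t = 0 := by
  have : innerSL ℂ t = 0 := hTensor_ext fun x y ↦ h x y
  exact inner_self_eq_zero.mp (DFunLike.congr_fun this t)

theorem inner_tmulL_hmap_id [CompleteSpace H] (f : H →L[ℂ] H) (x : H) (y : K) (t : HTensor H K) :
    inner ℂ (tmulL H K x y) (hmap f (.id ℂ K) t) = inner ℂ (tmulL H K (f.adjoint x) y) t := by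
  have : innerSL ℂ (tmulL H K x y) ∘L hmap f (.id ℂ K) = innerSL ℂ (tmulL H K (f.adjoint x) y) :=
    hTensor_ext fun a b ↦ by
      simp [hmap_tmulL, inner_tmulL_tmulL, ContinuousLinearMap.adjoint_inner_left]
  exact DFunLike.congr_fun this t

end Tensor

/-! ### Modular ideals and quasi-regularity -/

section Jacobson

variable {A : Type*} [AddCommGroup A] [Module ℂ A]

theorem IsLeftIdeal.eq_top_of_unit_mem {m : A →ₗ[ℂ] A →ₗ[ℂ] A} {I : Submodule ℂ A} {e : A}
    (hI : IsLeftIdeal m I) (he : ∀ a, a - m a e ∈ I) (h : e ∈ I) : I = ⊤ :=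
  (Submodule.eq_top_iff').mpr fun a ↦ by simpa using add_mem (he a) (hI a e h)

theorem isLeftIdeal_sSup_of_isChain {m : A →ₗ[ℂ] A →ₗ[ℂ] A} {c : Set (Submodule ℂ A)}
    (hne : c.Nonempty) (hc : IsChain (· ≤ ·) c) (h : ∀ I ∈ c, IsLeftIdeal m I) :
    IsLeftIdeal m (sSup c) := by
  intro a x hx
  rw [Submodule.mem_sSup_of_directed hne hc.directedOn] at hx ⊢
  obtain ⟨I, hI, hxI⟩ := hx
  exact ⟨I, hI, h I hI a x hxI⟩

/-- A proper left ideal that is modular with right modular unit `e` lies in a maximal modular left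
ideal that avoids `e`. -/
theorem exists_isMaximalModularLeftIdeal {m : A →ₗ[ℂ] A →ₗ[ℂ] A} {I : Submodule ℂ A} {e : A}
    (hI : IsLeftIdeal m I) (he : ∀ a, a - m a e ∈ I) (hne : I ≠ ⊤) :
    ∃ J, IsMaximalModularLeftIdeal m J ∧ e ∉ J := by
  -- Zorn is applied to avoiding `e` rather than to properness: the two agree for left ideals above
  -- `I`, and avoiding `e` visibly passes to unions of chains.
  obtain ⟨J, hIJ, hJ⟩ := zorn_le_nonempty₀ {J : Submodule ℂ A | IsLeftIdeal m J ∧ I ≤ J ∧ e ∉ J}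
    (fun c hcS hc J hJ ↦ ⟨sSup c, ⟨isLeftIdeal_sSup_of_isChain ⟨J, hJ⟩ hc fun K hK ↦ (hcS hK).1,
      (hcS hJ).2.1.trans (le_sSup hJ), fun hmem ↦ by
        rw [Submodule.mem_sSup_of_directed ⟨J, hJ⟩ hc.directedOn] at hmem
        obtain ⟨K, hK, heK⟩ := hmem
        exact (hcS hK).2.2 heK⟩, fun _ ↦ le_sSup⟩)
    I ⟨hI, le_rfl, fun h ↦ hne (IsLeftIdeal.eq_top_of_unit_mem hI he h)⟩
  refine ⟨J, ⟨⟨hJ.prop.1, e, fun a ↦ hIJ (he a)⟩, fun h ↦ hJ.prop.2.2 (h ▸ Submodule.mem_top),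
    fun K hK hJK ↦ ?_⟩, hJ.prop.2.2⟩
  by_contra hKtop
  refine hJK.not_ge (hJ.le_of_ge ⟨hK, hIJ.trans hJK.le, fun h ↦ hKtop ?_⟩ hJK.le)
  exact IsLeftIdeal.eq_top_of_unit_mem hK (fun a ↦ hJK.le (hIJ (he a))) h

/-- Elements of the Jacobson radical are left quasi-regular. -/
theorem exists_sub_mul_eq_of_mem_jacobsonRadical {m : A →ₗ[ℂ] A →ₗ[ℂ] A}
    (assoc : ∀ a b c, m (m a b) c = m a (m b c)) {e : A} (he : e ∈ jacobsonRadical m) (b : A) :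
    ∃ a, a - m a e = b := by
  -- `I = {a - ae}` is modular with unit `e` by construction. If it were proper, some maximal
  -- modular left ideal would miss `e`.
  let I : Submodule ℂ A := LinearMap.range (LinearMap.id - m.flip e)
  have hI : IsLeftIdeal m I := by
    rintro a _ ⟨x, rfl⟩
    exact ⟨m a x, by simp [assoc]⟩
  have htop : I = ⊤ := by
    by_contra hne
    obtain ⟨J, hJ, heJ⟩ := exists_isMaximalModularLeftIdeal hI (fun a ↦ ⟨a, rfl⟩) hne
    exact heJ (Submodule.mem_sInf.mp he J hJ)
  exact (htop ▸ Submodule.mem_top : b ∈ I)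

theorem mem_jacobsonRadical_of_mul_eq_zero {m : A →ₗ[ℂ] A →ₗ[ℂ] A} {u : A} (hu : m u = 0) :
    u ∈ jacobsonRadical m := by
  refine Submodule.mem_sInf.mpr fun I hI ↦ ?_
  obtain ⟨e, he⟩ := hI.1.2
  simpa [hu] using he u

end Jacobson

/-! ### Normality of the regular representation and the radical -/

section Frobenius

variable {H : Type*} [NormedAddCommGroup H] [InnerProductSpace ℂ H] {μ : HTensor H H →L[ℂ] H}

theorem IsCommSemigroup.mul_comm (hμ : IsCommSemigroup μ) (u v : H) :
    regularRep μ u v = regularRep μ v u := by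
  have := DFunLike.congr_fun hμ.comm (tmulL H H u v)
  rw [regularRep_apply, regularRep_apply, ← this]
  exact congrArg μ (symmetry_tmulL u v)

theorem IsCommSemigroup.mul_assoc (hμ : IsCommSemigroup μ) (u v w : H) :
    regularRep μ (regularRep μ u v) w = regularRep μ u (regularRep μ v w) := by
  have h := DFunLike.congr_fun hμ.assoc (tmulL _ _ (tmulL H H u v) w)
  change μ (hmap μ (.id ℂ H) _) = μ (hmap (.id ℂ H) μ (associator H H H _)) at h
  rwa [associator_tmulL, hmap_tmulL, hmap_tmulL] at h

variable [CompleteSpace H]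

/-- The adjoint of the multiplication is a morphism of left modules. -/
theorem IsFrobenius.adjoint_mul (hμ : IsFrobenius μ) (u v : H) :
    μ.adjoint (regularRep μ u v) = hmap (regularRep μ u) (.id ℂ H) (μ.adjoint v) := by
  have key : hmap μ (.id ℂ H) ∘L ((associator H H H).symm : _ →L[ℂ] HTensor (HTensor H H) H) ∘L
      tmulL H (HTensor H H) u = hmap (regularRep μ u) (.id ℂ H) := by
    refine hTensor_ext fun a b ↦ ?_
    change hmap μ (.id ℂ H) ((associator H H H).symm (tmulL H _ u (tmulL H H a b))) = _
    rw [← associator_tmulL, LinearIsometryEquiv.symm_apply_apply, hmap_tmulL, hmap_tmulL]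
    rfl
  have h := DFunLike.congr_fun hμ.left (tmulL H H u v)
  rw [← key]
  refine h.symm.trans ?_
  change hmap μ (.id ℂ H) ((associator H H H).symm (hmap (.id ℂ H) μ.adjoint _)) = _
  rw [hmap_tmulL]
  rfl

/-- Against `v`: `⟪xy, uv⟫ = ⟪x ⊗ y, μ†(uv)⟫ = ⟪x ⊗ y, (M_u ⊗ id) μ† v⟫ = ⟪M_u† x ⊗ y, μ† v⟫`. -/
theorem IsFrobenius.adjoint_regularRep_mul (hμ : IsFrobenius μ) (u x y : H) :
    (regularRep μ u).adjoint (regularRep μ x y) =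
      regularRep μ ((regularRep μ u).adjoint x) y := by
  refine ext_inner_right ℂ fun v ↦ ?_
  rw [ContinuousLinearMap.adjoint_inner_left, regularRep_apply μ x,
    ← ContinuousLinearMap.adjoint_inner_right, hμ.adjoint_mul, inner_tmulL_hmap_id,
    ContinuousLinearMap.adjoint_inner_right, ← regularRep_apply]

/-- The regular representation of a commutative Frobenius semigroup is by normal operators. -/
theorem IsCommFrobeniusSemigroup.isStarNormal (hμ : IsCommFrobeniusSemigroup μ) (u : H) :
    IsStarNormal (regularRep μ u) := by
  refine ⟨ContinuousLinearMap.ext fun x ↦ ?_⟩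
  change (regularRep μ u).adjoint (regularRep μ u x) =
    regularRep μ u ((regularRep μ u).adjoint x)
  rw [hμ.mul_comm u x, hμ.adjoint_regularRep_mul, hμ.mul_comm]

/-- Both sides say that `u` is orthogonal to all products, as `⟪μ† u, v ⊗ w⟫ = ⟪u, vw⟫ = ⟪M_v† u,
w⟫`. -/
theorem adjoint_eq_zero_iff (u : H) :
    μ.adjoint u = 0 ↔ ∀ v, (regularRep μ v).adjoint u = 0 := by
  refine ⟨fun h v ↦ ext_inner_right ℂ fun w ↦ ?_, fun h ↦ eq_zero_of_inner_tmulL fun x y ↦ ?_⟩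
  · rw [ContinuousLinearMap.adjoint_inner_left, regularRep_apply,
      ← ContinuousLinearMap.adjoint_inner_left, h, inner_zero_left, inner_zero_left]
  · rw [ContinuousLinearMap.adjoint_inner_left, ← regularRep_apply,
      ← ContinuousLinearMap.adjoint_inner_left, h, inner_zero_left]

theorem adjoint_eq_zero_iff_of_isStarNormal {T : H →L[ℂ] H} (hT : IsStarNormal T) (x : H) :
    T.adjoint x = 0 ↔ T x = 0 := by
  rw [← norm_eq_zero, ← norm_eq_zero (a := T x),
    (ContinuousLinearMap.isStarNormal_iff_norm_eq_adjoint.mp hT x)]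

/-- The kernels of `μ†` and of the regular representation coincide. -/
theorem IsCommFrobeniusSemigroup.adjoint_eq_zero_iff (hμ : IsCommFrobeniusSemigroup μ) (u : H) :
    μ.adjoint u = 0 ↔ regularRep μ u = 0 := by
  rw [HilbertianFrobenius.adjoint_eq_zero_iff, ContinuousLinearMap.ext_iff]
  refine forall_congr' fun v ↦ ?_
  rw [adjoint_eq_zero_iff_of_isStarNormal (hμ.isStarNormal v), hμ.mul_comm]
  rfl

/-- For normal `T`, `ker T = ker T†` is the orthogonal complement of the range. -/
theorem bijective_of_isStarNormal_of_surjective {T : H →L[ℂ] H} (hT : IsStarNormal T)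
    (hs : Function.Surjective T) : Function.Bijective T := by
  refine ⟨(injective_iff_map_eq_zero T).mpr fun x hx ↦ ?_, hs⟩
  obtain ⟨y, rfl⟩ := hs x
  rw [← inner_self_eq_zero (𝕜 := ℂ), ← ContinuousLinearMap.adjoint_inner_left,
    (adjoint_eq_zero_iff_of_isStarNormal hT _).mpr hx, inner_zero_left]

/-- The regular representation annihilates the Jacobson radical. -/
theorem IsCommFrobeniusSemigroup.regularRep_eq_zero (hμ : IsCommFrobeniusSemigroup μ) {x : H}
    (hx : x ∈ jacobsonRadical (regularRep μ).toLinearMap₁₂) : regularRep μ x = 0 := by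
  have hnormal := hμ.isStarNormal x
  have hspec : ∀ k ∈ spectrum ℂ (regularRep μ x), k = 0 := by
    intro k hk
    by_contra hk0
    refine hk ?_
    rw [spectrum.mem_resolventSet_iff, ContinuousLinearMap.isUnit_iff_bijective]
    refine bijective_of_isStarNormal_of_surjective ?_ fun b ↦ ?_
    · refine ⟨?_⟩
      rw [star_sub, ← algebraMap_star_comm]
      exact ((Algebra.commute_algebraMap_left _ _).sub_right
        (Algebra.commute_algebraMap_left _ _)).sub_left
        ((Algebra.commute_algebraMap_right _ _).sub_right hnormal.star_comm_self)
    -- Quasi-regularity of `k⁻¹x` solves `a - a(k⁻¹x) = k⁻¹b`; multiplied by `k`, this is `(k - M_x)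
    -- a = b`.
    · obtain ⟨a, ha⟩ := exists_sub_mul_eq_of_mem_jacobsonRadical
        (m := (regularRep μ).toLinearMap₁₂) hμ.mul_assoc (Submodule.smul_mem _ k⁻¹ hx) (k⁻¹ • b)
      refine ⟨a, ?_⟩
      have ha' : a - k⁻¹ • regularRep μ x a = k⁻¹ • b := by
        rw [← ha, map_smul, hμ.mul_comm]
        rfl
      have := congrArg (k • ·) ha'
      simpa [smul_sub, smul_smul, hk0, Algebra.algebraMap_eq_smul_one] using this
  -- As a supremum over the spectrum, this also covers `H = 0`, where the spectrum is empty.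
  have hr : spectralRadius ℂ (regularRep μ x) = 0 := by
    simp only [spectralRadius, ENNReal.iSup_eq_zero]
    intro k hk
    simp [hspec k hk]
  rw [IsStarNormal.spectralRadius_eq_nnnorm] at hr
  simpa using hr

theorem IsCommFrobeniusSemigroup.isSemisimple_iff (hμ : IsCommFrobeniusSemigroup μ) :
    IsSemisimple μ ↔ (regularRep μ).ker = ⊥ := by
  rw [IsSemisimple, Submodule.eq_bot_iff, Submodule.eq_bot_iff]
  refine ⟨fun h x hx ↦ h x (mem_jacobsonRadical_of_mul_eq_zero ?_),
    fun h x hx ↦ h x (hμ.regularRep_eq_zero hx)⟩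
  have hx' : regularRep μ x = 0 := hx
  ext v
  exact DFunLike.congr_fun hx' v

theorem IsCommFrobeniusSemigroup.ker_eq_bot_iff (hμ : IsCommFrobeniusSemigroup μ) :
    (regularRep μ).ker = ⊥ ↔ Function.Injective μ.adjoint := by
  rw [Submodule.eq_bot_iff, injective_iff_map_eq_zero]
  exact forall_congr' fun x ↦ imp_congr_left (hμ.adjoint_eq_zero_iff x).symm

end Frobenius

/-! ### Kernels and ranges of Hilbert adjoints -/

section Adjoint

variable {E F : Type*} [NormedAddCommGroup E] [InnerProductSpace ℂ E] [CompleteSpace E]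
  [NormedAddCommGroup F] [InnerProductSpace ℂ F] [CompleteSpace F]

theorem denseRange_iff_injective_adjoint (T : E →L[ℂ] F) :
    DenseRange T ↔ Function.Injective T.adjoint := by
  have h : DenseRange T ↔ T.range.topologicalClosure = ⊤ :=
    (Submodule.dense_iff_topologicalClosure_eq_top (s := T.range))
  rw [h, Submodule.topologicalClosure_eq_top_iff, ContinuousLinearMap.orthogonal_range,
    LinearMap.ker_eq_bot]
  rfl

/-- `⟪T T† x, x⟫ = ‖T† x‖²`, so `T T†` and `T†` have the same kernel. -/
theorem injective_comp_adjoint_iff (T : E →L[ℂ] F) :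
    Function.Injective (T ∘L T.adjoint) ↔ Function.Injective T.adjoint := by
  refine ⟨fun h ↦ Function.Injective.of_comp (f := T) h, fun h ↦ ?_⟩
  refine (injective_iff_map_eq_zero _).mpr fun x hx ↦ (injective_iff_map_eq_zero _).mp h x ?_
  have hx' : T (T.adjoint x) = 0 := hx
  rw [← inner_self_eq_zero (𝕜 := ℂ), ContinuousLinearMap.adjoint_inner_left, hx', inner_zero_right]

end Adjoint

end HilbertianFrobenius

theorem mainTheorem3 {H : Type*} [NormedAddCommGroup H] [InnerProductSpace ℂ H] [CompleteSpace H]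
    (μ : HilbertianFrobenius.HTensor H H →L[ℂ] H)
    (hμ : HilbertianFrobenius.IsCommFrobeniusSemigroup μ) :
    List.TFAE [
      HilbertianFrobenius.IsSemisimple μ,
      (HilbertianFrobenius.regularRep μ).ker = ⊥,
      DenseRange μ,
      Function.Injective μ.adjoint,
      Function.Injective (μ ∘L μ.adjoint)] ∧
    (HilbertianFrobenius.IsSpecial μ → HilbertianFrobenius.IsSemisimple μ) := by
  have h12 := hμ.isSemisimple_iff
  have h24 := hμ.ker_eq_bot_iff
  have h34 := HilbertianFrobenius.denseRange_iff_injective_adjoint μ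
  have h54 := HilbertianFrobenius.injective_comp_adjoint_iff μ
  refine ⟨?_, fun hs ↦ h12.mpr (h24.mpr (h54.mp ?_))⟩
  · tfae_have 1 ↔ 2 := h12
    tfae_have 2 ↔ 4 := h24
    tfae_have 3 ↔ 4 := h34
    tfae_have 5 ↔ 4 := h54
    tfae_finish
  · rw [show μ ∘L μ.adjoint = _ from hs]
    exact Function.injective_id
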